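/- Let $a<b$ be real numbers. A 2-players, 2-values, 3-strategies game is a pair of $3\times 3$ cost matrices $(\mu_1,\mu_2)$, $\mu_k(i,j)$ being the cost of player $k$ when player $1$ plays row $i$ and player $2$ plays column $j$, such that the set of all their entries is $\{a,b\}$. It is normal if no $(i,j)$ has $\mu_1(i,j)=\mu_2(i,j)=a$, each column of $\mu_1$ contains exactly one $a$, and each row of $\mu_2$ contains exactly one $a$. For mixed strategies $p_1,p_2$ (probability distributions on the three strategies) put $$x_k(p_1,p_2)=\sum_{(i,j):\,\mu_k(i,j)=a}p_1(i)\,p_2(j)\qquad(k=1,2).$$ Let $\mathsf F:[0,1]\to\mathbb R$ be unimodal, that is, $\mathsf F(0)=b$, $\mathsf F(1)=a$, and $\mathsf F$ is concave with a unique maximum point. An $\mathsf F$-equilibrium is a pair $(p_1,p_2)$ of mixed strategies such that $\mathsf F(x_1(p_1,p_2))\le \mathsf F(x_1(p_1',p_2))$ and $\mathsf F(x_2(p_1,p_2))\le \mathsf F(x_2(p_1,p_2'))$ for all mixed strategies $p_1',p_2'$. Then: (i) If $\mathsf F\left(\frac12\right)\le b$, every 2-players, 2-values, 3-strategies game has an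 $\mathsf F$-equilibrium. (ii) If $\mathsf F\left(\frac12\right)>b$, there is a normal 2-players, 2-values, 3-strategies game without $\mathsf F$-equilibrium; namely, the game $$\mathsf C_2=\begin{pmatrix}(a,b)&(b,a)&(a,b)\\(b,a)&(a,b)&(b,b)\\(b,b)&(b,b)&(b,a)\end{pmatrix}$$ (with entries $(\mu_1(i,j),\mu_2(i,j))$) is normal and has no $\mathsf F$-equilibrium. -/

import Mathlib

/-- A 2-players game in which both players have the strategies `0, …, n - 1`:
`cost₁ i j` and `cost₂ i j` are the costs of the row player and of the column player on the
profile `(i, j)`. -/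
structure BimatrixGame (n : ℕ) where
  cost₁ : Fin n → Fin n → ℝ
  cost₂ : Fin n → Fin n → ℝ

/-- A mixed strategy is a probability distribution on the `n` strategies. -/
abbrev MixedStrategy (n : ℕ) : Type := stdSimplex ℝ (Fin n)

/-- The total probability that the profile `(p, q)` puts on the entries with `μ i j = a`. -/
noncomputable def aWeight {n : ℕ} (a : ℝ) (μ : Fin n → Fin n → ℝ)
    (p q : MixedStrategy n) : ℝ :=
  open Classical in
  ∑ i : Fin n, ∑ j : Fin n, if μ i j = a then p.1 i * q.1 j else 0

/-- The functions `F : [0, 1] → ℝ` of unimodal valuations for the cost values `a` and `b`: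
`F 0 = b`, `F 1 = a`, and `F` is concave on `[0, 1]` with a unique maximum point.
Values of `F` outside `[0, 1]` play no role. -/
structure IsUnimodal (a b : ℝ) (F : ℝ → ℝ) : Prop where
  map_zero : F 0 = b
  map_one : F 1 = a
  concaveOn : ConcaveOn ℝ (Set.Icc 0 1) F
  existsUnique_max : ∃! x : ℝ, x ∈ Set.Icc (0 : ℝ) 1 ∧ IsMaxOn F (Set.Icc 0 1) x

namespace BimatrixGame

variable {n : ℕ}

/-- Exactly the two cost values `a` and `b` occur in the game. -/
def IsTwoValues (G : BimatrixGame n) (a b : ℝ) : Prop :=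
  {c : ℝ | ∃ i j, G.cost₁ i j = c ∨ G.cost₂ i j = c} = {a, b}

/-- Normal games: 2-values games without an `(a, a)` entry, in which the row player has
exactly one `a` per column and the column player has exactly one `a` per row. -/
structure IsNormal (G : BimatrixGame n) (a b : ℝ) : Prop where
  isTwoValues : G.IsTwoValues a b
  not_both : ∀ i j, ¬ (G.cost₁ i j = a ∧ G.cost₂ i j = a)
  col : ∀ j, ∃! i, G.cost₁ i j = a
  row : ∀ i, ∃! j, G.cost₂ i j = a

/-- The one-parameter valuation of the row player that is given by `F`. -/
noncomputable def val₁ (G : BimatrixGame n) (a : ℝ) (F : ℝ → ℝ) (p q : MixedStrategy n) : ℝ :=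
  F (aWeight a G.cost₁ p q)

/-- The one-parameter valuation of the column player that is given by `F`. -/
noncomputable def val₂ (G : BimatrixGame n) (a : ℝ) (F : ℝ → ℝ) (p q : MixedStrategy n) : ℝ :=
  F (aWeight a G.cost₂ p q)

/-- `(p, q)` is an `F`-equilibrium: each player's mixed strategy minimizes her valuation
against the mixed strategy of the other player. -/
def IsEquilibrium (G : BimatrixGame n) (a : ℝ) (F : ℝ → ℝ) (p q : MixedStrategy n) : Prop :=
  (∀ p' : MixedStrategy n, G.val₁ a F p q ≤ G.val₁ a F p' q) ∧
  (∀ q' : MixedStrategy n, G.val₂ a F p q ≤ G.val₂ a F p q')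

/-- The 3-strategies game `C₂`, with the bimatrix
`(a,b) (b,a) (a,b)` / `(b,a) (a,b) (b,b)` / `(b,b) (b,b) (b,a)`. -/
def gameC2 (a b : ℝ) : BimatrixGame 3 where
  cost₁ := !![a, b, a; b, a, b; b, b, b]
  cost₂ := !![b, a, b; a, b, b; b, b, a]

end BimatrixGame

/-! If `F (1 / 2) ≤ b`, concavity gives `F y ≤ F x` for `x ≤ y` with `1 / 2 ≤ y`, so a reply that
maximizes the weight of `a` is a best reply once that weight is at least one half
(`IsUnimodal.map_le_of_half_le`). It thus suffices to find uniform strategies on sets of rows and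
columns that either achieve this or leave the opponent indifferent. This is a finite problem about
two relations on `Fin 3` (`hasUniformEquilibrium_fin_three`): a single profile, a 2×2 cycle or full
support always works.

If `b < F (1 / 2)`, then `F > b` on `(0, 1 / 2]`. In `C₂` the third row secures weight 0, hence
value `b`, so at equilibrium the row player's weight is 0 or exceeds one half. Past one half `F`
strictly decreases from that point on, so the weight is maximal. Either way her strategy is pure,
and the column player's reply to it is one that she would not have met with that row. -/

/-! ### Combinatorics of uniform equilibria -/

open Classical in
/-- Against the uniform strategy on the columns in `T`, the uniform strategy on the rows in `S` is
a best reply of the row player, where `A` is the relation of the desired entries: either all rows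
are equally good, or each row in `S` is as good as possible, and wins at least half the time. -/
def IsUniformBestReply {n : ℕ} (A : Fin n → Fin n → Prop) (S T : Finset (Fin n)) : Prop :=
  (∀ i i', (T.filter (A i)).card = (T.filter (A i')).card) ∨
    ∀ i ∈ S, (∀ i', (T.filter (A i')).card ≤ (T.filter (A i)).card) ∧
      T.card ≤ 2 * (T.filter (A i)).card

/-- The uniform strategies on some sets of rows and columns are best replies to each other. -/
def HasUniformEquilibrium {n : ℕ} (A B : Fin n → Fin n → Prop) : Prop :=
  ∃ S T : Finset (Fin n), S.Nonempty ∧ T.Nonempty ∧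
    IsUniformBestReply A S T ∧ IsUniformBestReply (fun j i => B i j) T S

theorem HasUniformEquilibrium.swap {n : ℕ} {A B : Fin n → Fin n → Prop}
    (h : HasUniformEquilibrium (fun j i => B i j) (fun j i => A i j)) :
    HasUniformEquilibrium A B := by
  obtain ⟨S, T, hS, hT, h₁, h₂⟩ := h
  exact ⟨T, S, hT, hS, h₂, h₁⟩

theorem isUniformBestReply_singleton {n : ℕ} {A : Fin n → Fin n → Prop} {i j : Fin n}
    (h : A i j ∨ ∀ i', ¬ A i' j) : IsUniformBestReply A {i} {j} := by
  classical
  rcases h with h | h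
  · right
    intro i' hi'
    rw [Finset.mem_singleton] at hi'
    subst hi'
    simp only [Finset.filter_singleton, h, if_true, Finset.card_singleton]
    refine ⟨fun i' => ?_, by norm_num⟩
    split_ifs <;> simp
  · left
    intro i₁ i₂
    simp [Finset.filter_singleton, h]

theorem hasUniformEquilibrium_of_pure {n : ℕ} {A B : Fin n → Fin n → Prop} {i j : Fin n}
    (hA : A i j ∨ ∀ i', ¬ A i' j) (hB : B i j ∨ ∀ j', ¬ B i j') : HasUniformEquilibrium A B :=
  ⟨{i}, {j}, by simp, by simp, isUniformBestReply_singleton hA,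
    isUniformBestReply_singleton (A := fun j i => B i j) hB⟩

/-- No row wins on both columns, so `i₁` and `i₂`, winning on one of two, are optimal and meet the
threshold one half exactly. -/
theorem isUniformBestReply_pair {n : ℕ} {A : Fin n → Fin n → Prop} {i₁ i₂ j₁ j₂ : Fin n}
    (hj : j₁ ≠ j₂) (h₁ : A i₁ j₁) (h₂ : A i₂ j₂) (h : ∀ i, ¬ (A i j₁ ∧ A i j₂)) :
    IsUniformBestReply A {i₁, i₂} {j₁, j₂} := by
  classical
  right
  have key : ∀ i, (Finset.filter (A i) {j₁, j₂}).card ≤ 1 := by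
    intro i
    rw [Finset.filter_insert, Finset.filter_singleton]
    have := h i
    split_ifs <;> simp_all
  have pos : ∀ i ∈ ({i₁, i₂} : Finset (Fin n)), 1 ≤ (Finset.filter (A i) {j₁, j₂}).card := by
    intro i hi
    rw [Nat.succ_le_iff, Finset.card_pos]
    rw [Finset.mem_insert, Finset.mem_singleton] at hi
    rcases hi with rfl | rfl
    · exact ⟨j₁, by simp [h₁]⟩
    · exact ⟨j₂, by simp [h₂]⟩
  intro i hi
  refine ⟨fun i' => (key i').trans (pos i hi), ?_⟩
  rw [Finset.card_pair hj]
  linarith [pos i hi]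

theorem hasUniformEquilibrium_of_two_cycle {n : ℕ} {A B : Fin n → Fin n → Prop}
    {i₁ i₂ j₁ j₂ : Fin n} (hi : i₁ ≠ i₂) (hj : j₁ ≠ j₂) (h₁ : A i₁ j₁) (h₂ : A i₂ j₂)
    (h₃ : B i₁ j₂) (h₄ : B i₂ j₁) (hA : ∀ i, ¬ (A i j₁ ∧ A i j₂))
    (hB : ∀ j, ¬ (B i₁ j ∧ B i₂ j)) : HasUniformEquilibrium A B := by
  refine ⟨{i₁, i₂}, {j₁, j₂}, by simp, by simp, isUniformBestReply_pair hj h₁ h₂ hA, ?_⟩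
  rw [Finset.pair_comm j₁ j₂]
  exact isUniformBestReply_pair (A := fun j i => B i j) hi h₃ h₄ hB

/-- All rows win equally often, so no threshold is needed. -/
theorem isUniformBestReply_univ {n : ℕ} {A : Fin n → Fin n → Prop} (h : ∀ i, ∃! j, A i j)
    (S : Finset (Fin n)) : IsUniformBestReply A S Finset.univ := by
  classical
  left
  have key : ∀ i, (Finset.univ.filter (A i)).card = 1 := by
    intro i
    obtain ⟨j, hj, huniq⟩ := h i
    rw [Finset.card_eq_one]
    exact ⟨j, by ext x; simpa using ⟨fun hx => huniq x hx, fun hx => hx ▸ hj⟩⟩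
  intro i i'
  rw [key, key]

theorem isUniformBestReply_univ_not {n : ℕ} {A : Fin n → Fin n → Prop} (h : ∀ i, ∃! j, ¬ A i j)
    (S : Finset (Fin n)) : IsUniformBestReply A S Finset.univ := by
  classical
  left
  have key : ∀ i, (Finset.univ.filter (fun j => ¬ A i j)).card = 1 := by
    intro i
    obtain ⟨j, hj, huniq⟩ := h i
    rw [Finset.card_eq_one]
    exact ⟨j, by ext x; simpa using ⟨fun hx => huniq x hx, fun hx => hx ▸ hj⟩⟩
  intro i i'
  have h₁ := Finset.card_filter_add_card_filter_not (s := Finset.univ) (A i)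
  have h₂ := Finset.card_filter_add_card_filter_not (s := Finset.univ) (A i')
  rw [key] at h₁ h₂
  omega

theorem Fin.eq_or_eq_or_eq_of_ne {i₁ i₂ i₃ : Fin 3} (h₁₂ : i₁ ≠ i₂) (h₁₃ : i₁ ≠ i₃)
    (h₂₃ : i₂ ≠ i₃) (i : Fin 3) : i = i₁ ∨ i = i₂ ∨ i = i₃ := by
  omega

/-- The row player is indifferent on column `j₃`. Without a pure solution, each row therefore has a
`B` entry, and only in the columns `j₁`, `j₂`. Each of these two columns then has an `A` entry whose
row has `B` in the other one: a two-cycle. -/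
theorem hasUniformEquilibrium_of_zero_column {A B : Fin 3 → Fin 3 → Prop} {j₃ : Fin 3}
    (h : ∀ i, ¬ A i j₃) : HasUniformEquilibrium A B := by
  by_contra hcon
  have pure : ∀ i j, (A i j ∨ ∀ i', ¬ A i' j) → (B i j ∨ ∀ j', ¬ B i j') → False :=
    fun i j h₁ h₂ => hcon (hasUniformEquilibrium_of_pure h₁ h₂)
  have hB : ∀ i, ¬ B i j₃ ∧ ∃ j, B i j := by
    intro i
    refine ⟨fun hb => pure i j₃ (.inr h) (.inl hb), ?_⟩
    by_contra hn
    exact pure i j₃ (.inr h) (.inr (not_exists.1 hn))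
  obtain ⟨j₁, j₂, hj₁₂, hj₁₃, hj₂₃⟩ : ∃ j₁ j₂ : Fin 3, j₁ ≠ j₂ ∧ j₁ ≠ j₃ ∧ j₂ ≠ j₃ := by
    clear h hB
    revert j₃
    decide
  have hj := Fin.eq_or_eq_or_eq_of_ne hj₁₂ hj₁₃ hj₂₃
  have hrow : ∀ i, B i j₁ ∨ B i j₂ := by
    intro i
    obtain ⟨hn, j, hij⟩ := hB i
    rcases hj j with rfl | rfl | rfl <;> tauto
  have hcol : ∀ j j', j ≠ j₃ → j' ≠ j₃ → j ≠ j' → ∃ i, A i j ∧ ¬ B i j ∧ B i j' ∧ ¬ A i j' := by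
    intro j j' h₁ h₂ h₃
    have hne : ∃ i, A i j := by
      by_contra hno
      push Not at hno
      -- A `B` entry in the `A`-free column `j` would be a pure solution, so all rows have `B` in
      -- `j'`, which then contains a pure solution.
      have h₄ : ∀ i, B i j' := by
        intro i
        have := pure i j (.inr hno)
        have := hrow i
        rcases hj j with rfl | rfl | rfl <;> rcases hj j' with rfl | rfl | rfl <;> tauto
      by_cases h₅ : ∃ i, A i j'
      · obtain ⟨i, hi⟩ := h₅
        exact pure i j' (.inl hi) (.inl (h₄ i))
      · push Not at h₅
        exact pure 0 j' (.inr h₅) (.inl (h₄ 0))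
    obtain ⟨i, hi⟩ := hne
    have h₄ : ¬ B i j := fun hb => pure i j (.inl hi) (.inl hb)
    have h₅ : B i j' := by
      have := hrow i
      rcases hj j with rfl | rfl | rfl <;> rcases hj j' with rfl | rfl | rfl <;> tauto
    exact ⟨i, hi, h₄, h₅, fun ha => pure i j' (.inl ha) (.inl h₅)⟩
  obtain ⟨i₁, h₁, h₁', h₁'', h₁'''⟩ := hcol j₁ j₂ hj₁₃ hj₂₃ hj₁₂
  obtain ⟨i₂, h₂, h₂', h₂'', h₂'''⟩ := hcol j₂ j₁ hj₂₃ hj₁₃ hj₁₂.symm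
  refine hcon (hasUniformEquilibrium_of_two_cycle (i₁ := i₁) (i₂ := i₂) ?_ hj₁₂ h₁ h₂ h₁'' h₂''
    ?_ ?_)
  · rintro rfl
    exact h₁' h₂''
  · rintro i ⟨ha, ha'⟩
    rcases hrow i with hb | hb
    · exact pure i j₁ (.inl ha) (.inl hb)
    · exact pure i j₂ (.inl ha') (.inl hb)
  · rintro j ⟨hb, hb'⟩
    rcases hj j with rfl | rfl | rfl
    · exact h₁' hb
    · exact h₂' hb'
    · exact (hB _).1 hb

/-- Row `i₃` spoils the two-cycle by winning on both columns, so its `B` entry is at `j₃`. If `A i₂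
j₃`, then `B` is a permutation matrix with complement `A`, and full support works. Otherwise rows
`i₁, i₃` and columns `j₃, j₂` form an unspoiled two-cycle. -/
theorem hasUniformEquilibrium_of_two_cycle_of_mem {A B : Fin 3 → Fin 3 → Prop}
    (disj : ∀ i j, A i j → ¬ B i j)
    (row : ∀ i, ∃ j, B i j) {i₁ i₂ i₃ j₁ j₂ j₃ : Fin 3}
    (h₁ : A i₁ j₁) (h₂ : A i₂ j₂) (h₃ : B i₁ j₂) (h₄ : B i₂ j₁) (h₅ : A i₃ j₁) (h₆ : A i₃ j₂)
    (hj₁ : j₁ ≠ j₃) (hj₂ : j₂ ≠ j₃) (h₇ : A i₁ j₃) : HasUniformEquilibrium A B := by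
  have hj₁₂ : j₁ ≠ j₂ := by rintro rfl; exact disj _ _ h₁ h₃
  have hi₁₂ : i₁ ≠ i₂ := by rintro rfl; exact disj _ _ h₁ h₄
  have hi₁₃ : i₁ ≠ i₃ := by rintro rfl; exact disj _ _ h₆ h₃
  have hi₂₃ : i₂ ≠ i₃ := by rintro rfl; exact disj _ _ h₅ h₄
  have hi := Fin.eq_or_eq_or_eq_of_ne hi₁₂ hi₁₃ hi₂₃
  have hj := Fin.eq_or_eq_or_eq_of_ne hj₁₂ hj₁ hj₂
  have h₈ : B i₃ j₃ := by
    obtain ⟨j, hb⟩ := row i₃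
    rcases hj j with rfl | rfl | rfl
    · exact absurd hb (disj _ _ h₅)
    · exact absurd hb (disj _ _ h₆)
    · exact hb
  by_cases h₉ : A i₂ j₃
  · have hA : ∀ i j, A i j ↔ ¬ B i j := by
      refine fun i j => ⟨disj i j, fun hb => ?_⟩
      rcases hi i with rfl | rfl | rfl <;> rcases hj j with rfl | rfl | rfl <;> tauto
    refine ⟨Finset.univ, Finset.univ, by simp, by simp, isUniformBestReply_univ_not ?_ _,
      isUniformBestReply_univ ?_ _⟩
    · intro i
      simp only [hA, not_not] at *
      rcases hi i with rfl | rfl | rfl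
      · exact ⟨j₂, h₃, fun j hb => by rcases hj j with rfl | rfl | rfl <;> tauto⟩
      · exact ⟨j₁, h₄, fun j hb => by rcases hj j with rfl | rfl | rfl <;> tauto⟩
      · exact ⟨j₃, h₈, fun j hb => by rcases hj j with rfl | rfl | rfl <;> tauto⟩
    · intro j
      simp only [hA] at *
      rcases hj j with rfl | rfl | rfl
      · exact ⟨i₂, h₄, fun i hb => by rcases hi i with rfl | rfl | rfl <;> tauto⟩
      · exact ⟨i₁, h₃, fun i hb => by rcases hi i with rfl | rfl | rfl <;> tauto⟩
      · exact ⟨i₃, h₈, fun i hb => by rcases hi i with rfl | rfl | rfl <;> tauto⟩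
  · refine hasUniformEquilibrium_of_two_cycle hi₁₃ hj₂.symm h₇ h₆ h₃ h₈ ?_ ?_
    · rintro i ⟨ha, ha'⟩
      rcases hi i with rfl | rfl | rfl
      · exact disj _ _ ha' h₃
      · exact h₉ ha
      · exact disj _ _ ha h₈
    · rintro j ⟨hb, hb'⟩
      rcases hj j with rfl | rfl | rfl
      · exact disj _ _ h₁ hb
      · exact disj _ _ h₆ hb'
      · exact disj _ _ h₇ hb

theorem hasUniformEquilibrium_of_two_cycle_of_row {A B : Fin 3 → Fin 3 → Prop}
    (disj : ∀ i j, A i j → ¬ B i j) (col : ∀ j, ∃ i, A i j)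
    (row : ∀ i, ∃ j, B i j) {i₁ i₂ i₃ j₁ j₂ : Fin 3}
    (h₁ : A i₁ j₁) (h₂ : A i₂ j₂) (h₃ : B i₁ j₂) (h₄ : B i₂ j₁) (h₅ : A i₃ j₁) (h₆ : A i₃ j₂) :
    HasUniformEquilibrium A B := by
  have hi₁₂ : i₁ ≠ i₂ := by rintro rfl; exact disj _ _ h₁ h₄
  have hi₁₃ : i₁ ≠ i₃ := by rintro rfl; exact disj _ _ h₆ h₃
  have hi₂₃ : i₂ ≠ i₃ := by rintro rfl; exact disj _ _ h₅ h₄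
  obtain ⟨j₃, hb⟩ := row i₃
  have hj₁ : j₁ ≠ j₃ := by rintro rfl; exact disj _ _ h₅ hb
  have hj₂ : j₂ ≠ j₃ := by rintro rfl; exact disj _ _ h₆ hb
  obtain ⟨i, ha⟩ := col j₃
  rcases Fin.eq_or_eq_or_eq_of_ne hi₁₂ hi₁₃ hi₂₃ i with rfl | rfl | rfl
  · exact hasUniformEquilibrium_of_two_cycle_of_mem disj row h₁ h₂ h₃ h₄ h₅ h₆ hj₁ hj₂ ha
  · exact hasUniformEquilibrium_of_two_cycle_of_mem disj row h₂ h₁ h₄ h₃ h₆ h₅ hj₂ hj₁ ha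
  · exact absurd hb (disj _ _ ha)

/-- Alternately following `A` in a column and `B` in a row cannot close up after two rounds, so it
closes after three. Any further entry would violate `disj` or create a two-cycle; so `A` and `B` are
permutation matrices. -/
theorem hasUniformEquilibrium_of_three_cycle {A B : Fin 3 → Fin 3 → Prop}
    (col : ∀ j, ∃ i, A i j) (row : ∀ i, ∃ j, B i j) (disj : ∀ i j, A i j → ¬ B i j)
    (two : ∀ i₁ i₂ j₁ j₂, A i₁ j₁ → A i₂ j₂ → B i₁ j₂ → B i₂ j₁ → False) :
    HasUniformEquilibrium A B := by
  obtain ⟨i₁, a₁⟩ := col 0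
  generalize (0 : Fin 3) = j₁ at a₁
  obtain ⟨j₂, b₁⟩ := row i₁
  obtain ⟨i₂, a₂⟩ := col j₂
  obtain ⟨j₃, b₂⟩ := row i₂
  obtain ⟨i₃, a₃⟩ := col j₃
  have hj₁₂ : j₁ ≠ j₂ := by rintro rfl; exact disj _ _ a₁ b₁
  have hj₂₃ : j₂ ≠ j₃ := by rintro rfl; exact disj _ _ a₂ b₂
  have hj₁₃ : j₁ ≠ j₃ := by rintro rfl; exact two _ _ _ _ a₁ a₂ b₁ b₂
  have hi₁₂ : i₁ ≠ i₂ := by rintro rfl; exact disj _ _ a₂ b₁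
  have hi₂₃ : i₂ ≠ i₃ := by rintro rfl; exact disj _ _ a₃ b₂
  have hi₁₃ : i₁ ≠ i₃ := by rintro rfl; exact two _ _ _ _ a₂ a₃ b₂ b₁
  have hi := Fin.eq_or_eq_or_eq_of_ne hi₁₂ hi₁₃ hi₂₃
  have hj := Fin.eq_or_eq_or_eq_of_ne hj₁₂ hj₁₃ hj₂₃
  have b₃ : B i₃ j₁ := by
    obtain ⟨j, hb⟩ := row i₃
    rcases hj j with rfl | rfl | rfl
    · exact hb
    · exact (two _ _ _ _ a₃ a₂ hb b₂).elim
    · exact absurd hb (disj _ _ a₃)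
  refine ⟨Finset.univ, Finset.univ, by simp, by simp, isUniformBestReply_univ ?_ _,
    isUniformBestReply_univ ?_ _⟩
  · intro i
    rcases hi i with rfl | rfl | rfl
    · refine ⟨j₁, a₁, fun j ha => ?_⟩
      rcases hj j with rfl | rfl | rfl
      · rfl
      · exact absurd b₁ (disj _ _ ha)
      · exact (two _ _ _ _ ha a₂ b₁ b₂).elim
    · refine ⟨j₂, a₂, fun j ha => ?_⟩
      rcases hj j with rfl | rfl | rfl
      · exact (two _ _ _ _ ha a₃ b₂ b₃).elim
      · rfl
      · exact absurd b₂ (disj _ _ ha)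
    · refine ⟨j₃, a₃, fun j ha => ?_⟩
      rcases hj j with rfl | rfl | rfl
      · exact absurd b₃ (disj _ _ ha)
      · exact (two _ _ _ _ ha a₁ b₃ b₁).elim
      · rfl
  · intro j
    rcases hj j with rfl | rfl | rfl
    · refine ⟨i₃, b₃, fun i hb => ?_⟩
      rcases hi i with rfl | rfl | rfl
      · exact absurd hb (disj _ _ a₁)
      · exact (two _ _ _ _ a₁ a₂ b₁ hb).elim
      · rfl
    · refine ⟨i₁, b₁, fun i hb => ?_⟩
      rcases hi i with rfl | rfl | rfl
      · rfl
      · exact absurd hb (disj _ _ a₂)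
      · exact (two _ _ _ _ a₂ a₃ b₂ hb).elim
    · refine ⟨i₂, b₂, fun i hb => ?_⟩
      rcases hi i with rfl | rfl | rfl
      · exact (two _ _ _ _ a₁ a₃ hb b₃).elim
      · rfl
      · exact absurd hb (disj _ _ a₃)

theorem hasUniformEquilibrium_fin_three (A B : Fin 3 → Fin 3 → Prop) :
    HasUniformEquilibrium A B := by
  by_cases disj : ∀ i j, A i j → ¬ B i j
  swap
  · push Not at disj
    obtain ⟨i, j, ha, hb⟩ := disj
    exact hasUniformEquilibrium_of_pure (.inl ha) (.inl hb)
  by_cases col : ∀ j, ∃ i, A i j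
  swap
  · push Not at col
    obtain ⟨j, h⟩ := col
    exact hasUniformEquilibrium_of_zero_column h
  by_cases row : ∀ i, ∃ j, B i j
  swap
  · push Not at row
    obtain ⟨i, h⟩ := row
    exact (hasUniformEquilibrium_of_zero_column (A := fun j i => B i j) h).swap
  by_contra hcon
  refine hcon (hasUniformEquilibrium_of_three_cycle col row disj fun i₁ i₂ j₁ j₂ h₁ h₂ h₃ h₄ => ?_)
  refine hcon (hasUniformEquilibrium_of_two_cycle (i₁ := i₁) (i₂ := i₂) (j₁ := j₁) (j₂ := j₂)
    ?_ ?_ h₁ h₂ h₃ h₄ ?_ ?_)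
  · rintro rfl; exact disj _ _ h₁ h₄
  · rintro rfl; exact disj _ _ h₁ h₃
  · rintro i ⟨h₅, h₆⟩
    exact hcon (hasUniformEquilibrium_of_two_cycle_of_row disj col row h₁ h₂ h₃ h₄ h₅ h₆)
  · rintro j ⟨h₅, h₆⟩
    -- A column winning on both rows is the spoiled case of the transposed game.
    refine hcon (HasUniformEquilibrium.swap ?_)
    exact hasUniformEquilibrium_of_two_cycle_of_row (A := fun j i => B i j)
      (B := fun j i => A i j) (fun j i hb ha => disj _ _ ha hb) row col h₃ h₄ h₂ h₁ h₅ h₆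

/-! ### Weights and uniform strategies -/

open Classical in
theorem aWeight_eq_sum_mul {n : ℕ} (a : ℝ) (μ : Fin n → Fin n → ℝ) (p q : MixedStrategy n) :
    aWeight a μ p q = ∑ i, p.1 i * ∑ j, if μ i j = a then q.1 j else 0 := by
  simp only [aWeight, Finset.mul_sum, mul_ite, mul_zero]

theorem aWeight_swap {n : ℕ} (a : ℝ) (μ : Fin n → Fin n → ℝ) (p q : MixedStrategy n) :
    aWeight a μ p q = aWeight a (fun j i => μ i j) q p := by
  classical
  rw [aWeight, aWeight, Finset.sum_comm]
  simp only [mul_comm]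

/-- The uniform distribution on a nonempty set of strategies. -/
noncomputable def uniformStrategy {n : ℕ} (S : Finset (Fin n)) (hS : S.Nonempty) :
    MixedStrategy n :=
  ⟨fun i => if i ∈ S then (S.card : ℝ)⁻¹ else 0, by
    constructor
    · intro i
      dsimp only
      split_ifs <;> positivity
    · have : (S.card : ℝ) ≠ 0 := by exact_mod_cast hS.card_pos.ne'
      simp [Finset.sum_ite_mem, this]⟩

/-! ### Consequences of concavity -/

namespace IsUnimodal

variable {a b : ℝ} {F : ℝ → ℝ}

theorem le_map_mul (hF : IsUnimodal a b F) {t y : ℝ} (ht : 0 ≤ t) (ht1 : t ≤ 1) (hy : 0 ≤ y)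
    (hy1 : y ≤ 1) : (1 - t) * b + t * F y ≤ F (t * y) := by
  have := hF.concaveOn.2 (Set.left_mem_Icc.2 zero_le_one) ⟨hy, hy1⟩ (sub_nonneg.2 ht1) ht
    (sub_add_cancel 1 t)
  simpa only [smul_eq_mul, hF.map_zero, mul_zero, zero_add] using this

theorem min_le (hF : IsUnimodal a b F) {x y z : ℝ} (hx : 0 ≤ x) (hz : z ≤ 1) (hxy : x ≤ y)
    (hyz : y ≤ z) : min (F x) (F z) ≤ F y :=
  hF.concaveOn.min_le_of_mem_Icc ⟨hx, hxy.trans (hyz.trans hz)⟩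
    ⟨hx.trans (hxy.trans hyz), hz⟩ ⟨hxy, hyz⟩

/-- A concave function that has started to fall keeps falling. -/
theorem lt_of_lt (hF : IsUnimodal a b F) {x y z : ℝ} (hx : 0 ≤ x) (hz : z ≤ 1) (hxy : x < y)
    (hyz : y < z) (h : F y < F x) : F z < F y := by
  by_contra! hc
  obtain ⟨s, t, hs, ht, hst, rfl⟩ : y ∈ openSegment ℝ x z := by
    rw [openSegment_eq_Ioo (hxy.trans hyz)]; exact ⟨hxy, hyz⟩
  have := hF.concaveOn.2 ⟨hx, by linarith⟩ ⟨by linarith, hz⟩ hs.le ht.le hst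
  simp only [smul_eq_mul] at *
  have h₁ := mul_lt_mul_of_pos_left h hs
  have h₂ := mul_le_mul_of_nonneg_left hc ht.le
  have h₃ : F (s * x + t * z) = s * F (s * x + t * z) + t * F (s * x + t * z) := by
    rw [← add_mul, hst, one_mul]
  linarith

theorem lt_map (hF : IsUnimodal a b F) (h : b < F (1 / 2)) {x : ℝ} (hx : 0 < x)
    (hx' : x ≤ 1 / 2) : b < F x := by
  have h₁ := hF.le_map_mul (t := 2 * x) (y := 1 / 2) (by linarith) (by linarith) (by norm_num)
    (by norm_num)
  rw [show 2 * x * (1 / 2) = x by ring] at h₁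
  nlinarith

/-- The graph lies above the chord from `(0, b)` to `(1, a)`, which reaches `a` only at 1. -/
theorem eq_one_of_le (hF : IsUnimodal a b F) (hab : a < b) {x : ℝ} (h0 : 0 ≤ x) (h1 : x ≤ 1)
    (h : F x ≤ a) : x = 1 := by
  have h₁ := hF.le_map_mul h0 h1 zero_le_one le_rfl
  rw [hF.map_one, mul_one] at h₁
  nlinarith

theorem map_le_of_half_le (hF : IsUnimodal a b F) (h : F (1 / 2) ≤ b) {x y : ℝ} (hx : 0 ≤ x)
    (hxy : x ≤ y) (hy : 1 / 2 ≤ y) (hy1 : y ≤ 1) : F y ≤ F x := by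
  have h₁ : F y ≤ F (1 / 2) := by
    have := hF.min_le le_rfl hy1 (by norm_num : (0 : ℝ) ≤ 1 / 2) hy
    rw [hF.map_zero] at this
    by_contra! hc
    rcases h.lt_or_eq with hlt | heq
    · exact absurd this (not_le.2 (lt_min hlt hc))
    · rcases hy.lt_or_eq with hlt | heq'
      -- Here `F (1 / 2) = b < F y`, but the chord from 0 to `y` exceeds `b` at `1 / 2 = t * y`.
      · have h₃ := hF.le_map_mul (t := 1 / (2 * y)) (by positivity)
          (by rw [div_le_one (by linarith)]; linarith) (hx.trans hxy) hy1
        rw [show 1 / (2 * y) * y = 1 / 2 by field_simp] at h₃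
        have h₅ : 0 < 1 / (2 * y) := by positivity
        nlinarith
      · rw [← heq'] at hc
        exact lt_irrefl _ hc
  have h₂ := hF.min_le le_rfl hy1 hx hxy
  rw [hF.map_zero, min_eq_right (h₁.trans h)] at h₂
  exact h₂

end IsUnimodal

/-! ### From uniform best replies to equilibria -/

theorem map_aWeight_le_of_isUniformBestReply {a b : ℝ} {F : ℝ → ℝ} (hF : IsUnimodal a b F)
    (hhalf : F (1 / 2) ≤ b) {n : ℕ} {μ : Fin n → Fin n → ℝ} {S T : Finset (Fin n)}
    (hS : S.Nonempty) (hT : T.Nonempty) (h : IsUniformBestReply (fun i j => μ i j = a) S T)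
    (p : MixedStrategy n) :
    F (aWeight a μ (uniformStrategy S hS) (uniformStrategy T hT)) ≤
      F (aWeight a μ p (uniformStrategy T hT)) := by
  classical
  have hT0 : (0 : ℝ) < T.card := by exact_mod_cast hT.card_pos
  -- The pure row `i` has weight `c i / T.card` against the uniform strategy on `T`.
  set c : Fin n → ℕ := fun i => (T.filter (fun j => μ i j = a)).card with hc
  have hw : ∀ p : MixedStrategy n,
      aWeight a μ p (uniformStrategy T hT) = ∑ i, p.1 i * (c i / T.card) := by
    intro p
    rw [aWeight_eq_sum_mul]
    refine Finset.sum_congr rfl fun i _ => ?_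
    congr 1
    simp only [uniformStrategy, hc]
    rw [← Finset.sum_filter, Finset.sum_ite_mem, Finset.sum_const, nsmul_eq_mul, div_eq_mul_inv]
    congr 3
    ext j
    simp [and_comm]
  have hle1 : ∀ i, (c i : ℝ) / T.card ≤ 1 := fun i => by
    rw [div_le_one hT0]
    exact_mod_cast Finset.card_filter_le _ _
  rw [hw, hw]
  rcases h with h | h
  · obtain ⟨i₀, -⟩ := hS
    have key : ∀ p : MixedStrategy n, ∑ i, p.1 i * ((c i : ℝ) / T.card) = c i₀ / T.card := by
      intro p
      have : ∀ i, c i = c i₀ := fun i => by simpa only [hc] using h i i₀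
      simp only [this, ← Finset.sum_mul, p.2.2, one_mul]
    rw [key, key]
  · obtain ⟨i₀, hi₀⟩ := id hS
    have hmax : ∀ i, (c i : ℝ) / T.card ≤ c i₀ / T.card := fun i => by
      gcongr
      simpa only [hc] using (h i₀ hi₀).1 i
    have hpS : ∑ i, (uniformStrategy S hS).1 i * ((c i : ℝ) / T.card) = c i₀ / T.card := by
      have : ∀ i, (uniformStrategy S hS).1 i * ((c i : ℝ) / T.card) =
          (uniformStrategy S hS).1 i * ((c i₀ : ℝ) / T.card) := by
        intro i
        by_cases hi : i ∈ S
        · have h₁ : c i₀ ≤ c i := by simpa only [hc] using (h i hi).1 i₀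
          have h₂ : c i ≤ c i₀ := by simpa only [hc] using (h i₀ hi₀).1 i
          rw [le_antisymm h₂ h₁]
        · simp [uniformStrategy, hi]
      simp only [this, ← Finset.sum_mul, (uniformStrategy S hS).2.2, one_mul]
    rw [hpS]
    refine hF.map_le_of_half_le hhalf ?_ ?_ ?_ (hle1 i₀)
    · exact Finset.sum_nonneg fun i _ => mul_nonneg (p.2.1 i) (by positivity)
    · calc ∑ i, p.1 i * ((c i : ℝ) / T.card) ≤ ∑ i, p.1 i * ((c i₀ : ℝ) / T.card) :=
            Finset.sum_le_sum fun i _ => mul_le_mul_of_nonneg_left (hmax i) (p.2.1 i)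
        _ = c i₀ / T.card := by rw [← Finset.sum_mul, p.2.2, one_mul]
    · rw [le_div_iff₀ hT0]
      have : T.card ≤ 2 * c i₀ := by simpa only [hc] using (h i₀ hi₀).2
      have : (T.card : ℝ) ≤ 2 * c i₀ := by exact_mod_cast this
      linarith

namespace BimatrixGame

theorem exists_isEquilibrium {a b : ℝ} {F : ℝ → ℝ} (hF : IsUnimodal a b F)
    (hhalf : F (1 / 2) ≤ b) (G : BimatrixGame 3) :
    ∃ p q : MixedStrategy 3, G.IsEquilibrium a F p q := by
  obtain ⟨S, T, hS, hT, h₁, h₂⟩ :=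
    hasUniformEquilibrium_fin_three (fun i j => G.cost₁ i j = a) (fun i j => G.cost₂ i j = a)
  refine ⟨uniformStrategy S hS, uniformStrategy T hT, fun p' => ?_, fun q' => ?_⟩
  · exact map_aWeight_le_of_isUniformBestReply hF hhalf hS hT h₁ p'
  · rw [val₂, val₂, aWeight_swap, aWeight_swap _ _ _ q']
    exact map_aWeight_le_of_isUniformBestReply (μ := fun j i => G.cost₂ i j) hF hhalf hT hS h₂ q'

/-! ### The game `C₂` -/

theorem isNormal_gameC2 {a b : ℝ} (hab : a < b) : (gameC2 a b).IsNormal a b := by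
  have hne := hab.ne'
  constructor
  · ext c
    simp only [gameC2, Set.mem_ofPred_eq, Set.mem_insert_iff, Set.mem_singleton_iff]
    constructor
    · rintro ⟨i, j, h⟩
      fin_cases i <;> fin_cases j <;> simp at h <;> grind
    · rintro (rfl | rfl)
      · exact ⟨0, 0, .inl rfl⟩
      · exact ⟨0, 0, .inr rfl⟩
  · intro i j
    fin_cases i <;> fin_cases j <;> simp [gameC2, hne]
  · intro j
    fin_cases j
    · exact ⟨0, rfl, fun i hi => by fin_cases i <;> simp_all [gameC2]⟩
    · exact ⟨1, rfl, fun i hi => by fin_cases i <;> simp_all [gameC2]⟩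
    · exact ⟨0, rfl, fun i hi => by fin_cases i <;> simp_all [gameC2]⟩
  · intro i
    fin_cases i
    · exact ⟨1, rfl, fun j hj => by fin_cases j <;> simp_all [gameC2]⟩
    · exact ⟨0, rfl, fun j hj => by fin_cases j <;> simp_all [gameC2]⟩
    · exact ⟨2, rfl, fun j hj => by fin_cases j <;> simp_all [gameC2]⟩

theorem aWeight_gameC2_cost₁ {a b : ℝ} (hab : a < b) (p q : MixedStrategy 3) :
    aWeight a (gameC2 a b).cost₁ p q = p.1 0 * (q.1 0 + q.1 2) + p.1 1 * q.1 1 := by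
  simp [aWeight, gameC2, Fin.sum_univ_three, hab.ne']
  ring

theorem aWeight_gameC2_cost₂ {a b : ℝ} (hab : a < b) (p q : MixedStrategy 3) :
    aWeight a (gameC2 a b).cost₂ p q = p.1 1 * q.1 0 + p.1 0 * q.1 1 + p.1 2 * q.1 2 := by
  simp [aWeight, gameC2, Fin.sum_univ_three, hab.ne']
  ring

theorem not_isEquilibrium_gameC2 {a b : ℝ} (hab : a < b) {F : ℝ → ℝ} (hF : IsUnimodal a b F)
    (hhalf : b < F (1 / 2)) (p q : MixedStrategy 3) : ¬ (gameC2 a b).IsEquilibrium a F p q := by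
  rintro ⟨h₁, h₂⟩
  simp only [val₁, aWeight_gameC2_cost₁ hab] at h₁
  simp only [val₂, aWeight_gameC2_cost₂ hab] at h₂
  -- Deviations to pure strategies suffice.
  have r (i : Fin 3) := h₁ ⟨Pi.single i 1, single_mem_stdSimplex ℝ i⟩
  have c (i : Fin 3) := h₂ ⟨Pi.single i 1, single_mem_stdSimplex ℝ i⟩
  have hp := p.2.2
  have hq := q.2.2
  rw [Fin.sum_univ_three] at hp hq
  have r₀ := r 0
  have r₁ := r 1
  have r₂ := r 2
  have c₀ := c 0
  have c₁ := c 1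
  have c₂ := c 2
  simp only [Pi.single_apply, Fin.reduceEq, if_true, if_false, one_mul, zero_mul, add_zero,
    zero_add, mul_one, mul_zero, hF.map_zero] at r₀ r₁ r₂ c₀ c₁ c₂
  have hp₀ := p.2.1 0
  have hp₁ := p.2.1 1
  have hp₂ := p.2.1 2
  have hq₀ := q.2.1 0
  have hq₁ := q.2.1 1
  have hq₂ := q.2.1 2
  generalize p.1 0 = p₀, p.1 1 = p₁, p.1 2 = p₂, q.1 0 = q₀, q.1 1 = q₁, q.1 2 = q₂ at *
  have hx₀ : 0 ≤ p₀ * (q₀ + q₂) + p₁ * q₁ := by positivity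
  have hx₁ : p₀ * (q₀ + q₂) + p₁ * q₁ ≤ 1 := by nlinarith
  have hy₀ : 0 ≤ p₁ * q₀ + p₀ * q₁ + p₂ * q₂ := by positivity
  have hy₁ : p₁ * q₀ + p₀ * q₁ + p₂ * q₂ ≤ 1 := by nlinarith
  rcases hx₀.eq_or_lt with hx | hx
  · rw [← hx, hF.map_zero] at r₀ r₁
    -- Weight 0 has value `b`, so no row may secure weight 1. Both top rows then have positive
    -- weight and are not played; the bottom row forces `q₂ = 1`, against `q₁ > 0`.
    have hq₁' : q₁ ≠ 1 := by
      rintro rfl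
      rw [hF.map_one] at r₁
      linarith
    have hq₀₂ : q₀ + q₂ ≠ 1 := by
      intro h
      rw [h, hF.map_one] at r₀
      linarith
    have hq₁'' : 0 < q₁ := hq₁.lt_of_ne fun h => hq₀₂ (by linarith)
    have hq₀₂' : 0 < q₀ + q₂ := (add_nonneg hq₀ hq₂).lt_of_ne fun h => hq₁' (by linarith)
    have hp₀' : p₀ = 0 := by
      by_contra h
      have := mul_pos (hp₀.lt_of_ne' h) hq₀₂'
      have := mul_nonneg hp₁ hq₁
      linarith
    have hp₁' : p₁ = 0 := by
      by_contra h
      have := mul_pos (hp₁.lt_of_ne' h) hq₁''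
      have := mul_nonneg hp₀ hq₀₂'.le
      linarith
    have hp₂' : p₂ = 1 := by linarith
    subst hp₀' hp₁' hp₂'
    rw [hF.map_one] at c₂
    have := hF.eq_one_of_le hab hy₀ hy₁ c₂
    linarith
  · have hx' : 1 / 2 < p₀ * (q₀ + q₂) + p₁ * q₁ := by
      by_contra! h
      exact absurd r₂ (not_le.2 (hF.lt_map hhalf hx h))
    have hmax : ∀ z, z ≤ 1 → F (p₀ * (q₀ + q₂) + p₁ * q₁) ≤ F z →
        z ≤ p₀ * (q₀ + q₂) + p₁ * q₁ := by
      intro z hz h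
      by_contra! hlt
      exact absurd h (not_le.2 (hF.lt_of_lt (by norm_num) hz hx' hlt (r₂.trans_lt hhalf)))
    have m₀ := hmax _ (by linarith) r₀
    have m₁ := hmax _ (by linarith) r₁
    -- The top rows have weights `1 - q₁` and `q₁`. The larger one must be played purely, and the
    -- column player's answer reverses the comparison; at equality the weight is at most one half.
    rcases lt_trichotomy q₁ (1 / 2) with h | h | h
    · have hp₀' : p₀ = 1 := by
        by_contra hne
        have : p₀ < 1 := lt_of_le_of_ne (by linarith) hne
        nlinarith
      have hp₁' : p₁ = 0 := by linarith
      have hp₂' : p₂ = 0 := by linarith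
      subst hp₀' hp₁' hp₂'
      rw [hF.map_one] at c₁
      have := hF.eq_one_of_le hab hy₀ hy₁ c₁
      linarith
    · nlinarith
    · have hp₁' : p₁ = 1 := by
        by_contra hne
        have : p₁ < 1 := lt_of_le_of_ne (by linarith) hne
        nlinarith
      have hp₀' : p₀ = 0 := by linarith
      have hp₂' : p₂ = 0 := by linarith
      subst hp₀' hp₁' hp₂'
      rw [hF.map_one] at c₀
      have := hF.eq_one_of_le hab hy₀ hy₁ c₀
      linarith

end BimatrixGame

theorem mainTheorem7 (a b : ℝ) (hab : a < b) (F : ℝ → ℝ) (hF : IsUnimodal a b F) :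
    (F (1 / 2) ≤ b →
      ∀ G : BimatrixGame 3, G.IsTwoValues a b →
        ∃ p q : MixedStrategy 3, G.IsEquilibrium a F p q) ∧
    (b < F (1 / 2) →
      (BimatrixGame.gameC2 a b).IsNormal a b ∧
        ¬ ∃ p q : MixedStrategy 3, (BimatrixGame.gameC2 a b).IsEquilibrium a F p q) := by
  refine ⟨fun h G _ => G.exists_isEquilibrium hF h, fun h => ⟨BimatrixGame.isNormal_gameC2 hab, ?_⟩⟩
  rintro ⟨p, q, hpq⟩
  exact BimatrixGame.not_isEquilibrium_gameC2 hab hF h p q hpq
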